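/- Let $d \ge 1$, let $A \in \mathbb{R}^{d\times d}$ be symmetric, $b \in \mathbb{R}^d$, $R > 0$, let $\|\cdot\|$ be the Euclidean norm and put $f(x) = \tfrac12 x^T A x + b^T x$. Let $\lambda_{\min}$ and $\lambda_{\max}$ be the smallest and largest eigenvalues of $A$, let $v_{\min}$ be any unit eigenvector of $A$ with eigenvalue $\lambda_{\min}$, and put $b^{(1)} = v_{\min}^T b$. Let $s_{\mathrm{tr}}$ be any solution of the trust-region problem, that is, a minimizer of $f$ over $\{x : \|x\| \le R\}$. Then there is exactly one real number $\lambda_{\mathrm{tr}}$ (the Lagrange multiplier) such that $$(A + \lambda_{\mathrm{tr}} I)s_{\mathrm{tr}} + b = 0, \qquad \lambda_{\mathrm{tr}} \ge \max\{-\lambda_{\min}, 0\}, \qquad \lambda_{\mathrm{tr}}(R - \|s_{\mathrm{tr}}\|) = 0.$$ For every integer $t \ge 1$, let $x_t$ be any Krylov-subspace solution of order $t$, that is, a minimizer of $f$ over $\{x \in \mathcal{K}_t(A,b) : \|x\| \le R\}$, where $\mathcal{K}_t(A,b) = \mathrm{span}\{b, Ab, \dots, A^{t-1}b\}$. Then $$f(x_t)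 - f(s_{\mathrm{tr}}) \le 36\,[f(0) - f(s_{\mathrm{tr}})]\,\exp\left(-4t\sqrt{\frac{\lambda_{\min}+\lambda_{\mathrm{tr}}}{\lambda_{\max}+\lambda_{\mathrm{tr}}}}\right),$$ where the quotient is read as $0$ if $\lambda_{\max}+\lambda_{\mathrm{tr}} = 0$. Moreover, if $\lambda_{\min} \ge 0$ or $b^{(1)} \neq 0$, then $$f(x_t) - f(s_{\mathrm{tr}}) \le \frac{(\lambda_{\max}-\lambda_{\min})\|s_{\mathrm{tr}}\|^2}{(t-\frac12)^2}\left[4 + \frac{\mathbf{1}\{\lambda_{\min}<0\}}{8}\,\log^2\left(\frac{4\|b\|^2}{(b^{(1)})^2}\right)\right],$$ where the logarithmic term is absent (equal to $0$) if $\lambda_{\min} \ge 0$. -/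

import Mathlib

noncomputable section

/-- The quadratic objective `x ↦ ½ xᵀ A x + bᵀ x` on Euclidean space. -/
def quadObj {d : ℕ} (A : Matrix (Fin d) (Fin d) ℝ) (b x : EuclideanSpace ℝ (Fin d)) : ℝ :=
  1 / 2 * inner ℝ x (A.toEuclideanLin x) + inner ℝ b x

/-- The Krylov subspace of order `t`, spanned by `b, A b, …, A ^ (t - 1) b`. -/
def krylovSpace {d : ℕ} (A : Matrix (Fin d) (Fin d) ℝ) (b : EuclideanSpace ℝ (Fin d)) (t : ℕ) :
    Submodule ℝ (EuclideanSpace ℝ (Fin d)) :=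
  Submodule.span ℝ {x | ∃ i : ℕ, i < t ∧ x = (A ^ i).toEuclideanLin b}

/-- The smallest eigenvalue (for symmetric `A` and `0 < d` the real spectrum is finite and
nonempty). -/
def lambdaMin {d : ℕ} (A : Matrix (Fin d) (Fin d) ℝ) : ℝ := sInf (spectrum ℝ A)

/-- The largest eigenvalue. -/
def lambdaMax {d : ℕ} (A : Matrix (Fin d) (Fin d) ℝ) : ℝ := sSup (spectrum ℝ A)

/-- `x` minimizes `g` over the set `S`. -/
def IsMinimizer {d : ℕ} (g : EuclideanSpace ℝ (Fin d) → ℝ) (S : Set (EuclideanSpace ℝ (Fin d)))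
    (x : EuclideanSpace ℝ (Fin d)) : Prop :=
  x ∈ S ∧ IsMinOn g S x

/-- `s` solves the trust-region problem: minimize `quadObj A b x` subject to `‖x‖ ≤ R`. -/
def IsTRSolution {d : ℕ} (A : Matrix (Fin d) (Fin d) ℝ) (b : EuclideanSpace ℝ (Fin d)) (R : ℝ)
    (s : EuclideanSpace ℝ (Fin d)) : Prop :=
  IsMinimizer (quadObj A b) {x | ‖x‖ ≤ R} s

/-- `x` is an order `t` Krylov subspace solution of the trust-region problem. -/
def IsKrylovTRSolution {d : ℕ} (A : Matrix (Fin d) (Fin d) ℝ) (b : EuclideanSpace ℝ (Fin d))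
    (R : ℝ) (t : ℕ) (x : EuclideanSpace ℝ (Fin d)) : Prop :=
  IsMinimizer (quadObj A b) {y | y ∈ krylovSpace A b t ∧ ‖y‖ ≤ R} x

/-- `lam` is the Lagrange multiplier (dual parameter) of the trust-region problem at `s`. -/
def IsTRMultiplier {d : ℕ} (A : Matrix (Fin d) (Fin d) ℝ) (b : EuclideanSpace ℝ (Fin d)) (R : ℝ)
    (s : EuclideanSpace ℝ (Fin d)) (lam : ℝ) : Prop :=
  A.toEuclideanLin s + lam • s + b = 0 ∧ max (-lambdaMin A) 0 ≤ lam ∧ lam * (R - ‖s‖) = 0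

end

/-! Since x_t is a minimizer, it suffices to exhibit one good feasible point in each Krylov space.
These spaces are compatible with every shift A + c, so iterations and polynomials in a shifted
operator are available.

Linear rate. With the multiplier λ, f(x) − f(s) = ½⟨x − s, (A + λ)(x − s)⟩ + (λ/2)(‖s‖² − ‖x‖²)
(`quadratic_sub_eq`). If A + λ is positive definite, a Chebyshev polynomial q with q(0) = 1 that is
small on the spectrum gives the Krylov vector (1 − q(A + λ))s. Rescaling it to norm ‖s‖ removes the
second term and at most triples the bound on the relative error in each eigencoordinate
(`exists_normalized_linear_approx`).

Sublinear rate. Shifting by −λ_min makes the quadratic convex, and accelerated projected gradient,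
whose iterates are Krylov vectors, has error O(1/t²) (`exists_convex_ball_approx`). If λ_min ≥ 0,
undoing the shift only helps points no longer than s. If λ_min < 0, then s lies on the sphere, and
the iterate is pushed onto it along a Krylov vector z, in the direction where the first-order term
does not increase. The cost is the Rayleigh quotient of z, made small by a third-kind Chebyshev
polynomial (`exists_approx_null_vector`). -/

/-! ### Chebyshev polynomials: an identity and a growth bound. -/

open Polynomial in
/-- The Chebyshev polynomial of the third kind `U n - U (n - 1)` satisfies
`(1 + X) (U n - U (n - 1))² = 1 + T (2 n + 1)`. -/
theorem one_add_X_mul_sq_U_sub_U (n : ℤ) :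
    (1 + X) * (Chebyshev.U ℝ n - Chebyshev.U ℝ (n - 1)) ^ 2 =
      1 + Chebyshev.T ℝ (2 * n + 1) := by
  have hU : Chebyshev.U ℝ (n - 1) ^ 2 + Chebyshev.U ℝ n ^ 2
      - 2 * X * Chebyshev.U ℝ (n - 1) * Chebyshev.U ℝ n = 1 := by
    have h := congrArg (fun p => p.comp (2 * X)) (Chebyshev.S_sq_add_S_sq ℝ (n - 1))
    simpa [Chebyshev.S_comp_two_mul_X] using h
  have hT := Chebyshev.T_mul_T ℝ (n + 1) n
  have e1 : n + 1 + n = 2 * n + 1 := by ring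
  have e2 : n + 1 - n = 1 := by ring
  rw [e1, e2, Chebyshev.T_one] at hT
  have h1 := Chebyshev.T_eq_U_sub_X_mul_U ℝ n
  have h2 := Chebyshev.T_eq_X_mul_U_sub_U ℝ (n - 1)
  have e3 : n - 1 + 2 = n + 1 := by ring
  have e4 : n - 1 + 1 = n := by ring
  rw [e3, e4] at h2
  rw [h1, h2] at hT
  linear_combination hT + (1 - X) * hU

/-- The Chebyshev polynomial `T n` grows at least like `exp (2 n r) / 2` at
`(1 + r²) / (1 - r²)`. -/
theorem half_exp_le_eval_T (n : ℕ) {r : ℝ} (hr0 : 0 ≤ r) (hr1 : r < 1) :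
    Real.exp (2 * n * r) / 2 ≤
      (Polynomial.Chebyshev.T ℝ n).eval ((1 + r ^ 2) / (1 - r ^ 2)) := by
  have hp : 0 < 1 - r := by linarith
  have hq : 0 < 1 + r := by linarith
  have hpq : 0 < (1 + r) / (1 - r) := by positivity
  -- η = 2 artanh r, so the evaluation point is cosh η and `T n` takes the value cosh(nη) there; the
  -- first term of the series of η gives η ≥ 2r.
  set η := Real.log ((1 + r) / (1 - r)) with hη
  have hlog : 2 * r ≤ η := by
    rw [hη, Real.log_div hq.ne' hp.ne']
    have hs := Real.hasSum_log_sub_log_of_abs_lt_one (x := r) (by rwa [abs_of_nonneg hr0])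
    have := hs.summable.le_tsum 0 (fun k _ => by positivity)
    rw [hs.tsum_eq] at this
    simpa using this
  have hcosh : Real.cosh η = (1 + r ^ 2) / (1 - r ^ 2) := by
    rw [Real.cosh_eq, Real.exp_neg, hη, Real.exp_log hpq]
    have : 1 - r ^ 2 ≠ 0 := by nlinarith
    field_simp
    ring
  rw [← hcosh, Polynomial.Chebyshev.T_real_cosh, Real.cosh_eq]
  have h1 : Real.exp (2 * n * r) ≤ Real.exp (((n : ℤ) : ℝ) * η) := by
    apply Real.exp_le_exp.mpr
    push_cast
    nlinarith [(Nat.cast_nonneg n : (0 : ℝ) ≤ n)]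
  have := Real.exp_pos (-(((n : ℤ) : ℝ) * η))
  linarith

/-! ### Accelerated projected gradient on a ball. -/

section ball

variable {E : Type*} [NormedAddCommGroup E] [InnerProductSpace ℝ E]

/-- The metric projection onto a centred ball is a rescaling. -/
theorem exists_smul_ball_projection {R : ℝ} (hR : 0 ≤ R) (w : E) :
    ∃ c : ℝ, ‖c • w‖ ≤ R ∧ ∀ s : E, ‖s‖ ≤ R → inner ℝ (w - c • w) (s - c • w) ≤ 0 := by
  by_cases hw : ‖w‖ ≤ R
  · exact ⟨1, by simpa using hw, by simp⟩
  · have hw : R < ‖w‖ := not_le.mp hw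
    have hw0 : 0 < ‖w‖ := hR.trans_lt hw
    have hc : R / ‖w‖ * ‖w‖ = R := by field_simp
    have hc1 : R / ‖w‖ ≤ 1 := (div_le_one hw0).mpr hw.le
    refine ⟨R / ‖w‖, ?_, fun s hs => ?_⟩
    · rw [norm_smul, Real.norm_of_nonneg (by positivity), hc]
    · have h1 : inner ℝ w s ≤ ‖w‖ * R :=
        (real_inner_le_norm w s).trans (by gcongr)
      have h2 : w - (R / ‖w‖) • w = (1 - R / ‖w‖) • w := by rw [sub_smul, one_smul]
      rw [h2, inner_smul_left, inner_sub_right, inner_smul_right, real_inner_self_eq_norm_sq]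
      have h3 : R / ‖w‖ * ‖w‖ ^ 2 = ‖w‖ * R := by rw [pow_two, ← mul_assoc, hc]; ring
      rw [h3]
      exact mul_nonpos_of_nonneg_of_nonpos (by simpa using hc1) (by linarith)

theorem LinearMap.IsSymmetric.quadratic_add {T : E →ₗ[ℝ] E} (hT : T.IsSymmetric) (b p h : E) :
    1 / 2 * inner ℝ (p + h) (T (p + h)) + inner ℝ b (p + h) =
      1 / 2 * inner ℝ p (T p) + inner ℝ b p + inner ℝ (T p + b) h + 1 / 2 * inner ℝ h (T h) := by
  have e1 : inner ℝ p (T h) = inner ℝ (T p) h := (hT p h).symm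
  have e2 : inner ℝ h (T p) = inner ℝ (T p) h := real_inner_comm _ _
  simp only [map_add, inner_add_left, inner_add_right, e1, e2]
  ring

/-- Accelerated projected gradient descent: its iterates stay in any chain of subspaces
containing `b` and compatible with `T`. -/
theorem exists_accelerated_iterates (T : E →ₗ[ℝ] E) (hT : T.IsSymmetric) {L : ℝ} (hL : 0 < L)
    (h0 : ∀ x, 0 ≤ inner ℝ x (T x)) (h1 : ∀ x, inner ℝ x (T x) ≤ L * ‖x‖ ^ 2) (b s : E)
    (K : ℕ → Submodule ℝ E) (hKmono : Monotone K) (hKb : ∀ n, b ∈ K (n + 1))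
    (hKT : ∀ n, ∀ x ∈ K n, T x ∈ K (n + 1)) (t : ℕ) :
    ∃ x ∈ K t, ∃ z ∈ K t, ‖x‖ ≤ ‖s‖ ∧ ‖z‖ ≤ ‖s‖ ∧
      (t : ℝ) ^ 2 / 4 * ((1 / 2 * inner ℝ x (T x) + inner ℝ b x)
        - (1 / 2 * inner ℝ s (T s) + inner ℝ b s)) + L / 2 * ‖z - s‖ ^ 2 ≤
        L / 2 * ‖s‖ ^ 2 := by
  induction t with
  | zero => exact ⟨0, zero_mem _, 0, zero_mem _, by simp, by simp, by simp⟩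
  | succ t ih =>
    obtain ⟨x, hxK, z, hzK, hx, hz, hpot⟩ := ih
    -- The potential weighs the gap by t²/4; `a` is the increment of this weight and `B` its new
    -- value. Acceleration needs exactly a² ≤ B.
    set a : ℝ := (2 * t + 1) / 4 with ha
    set B : ℝ := ((t : ℝ) + 1) ^ 2 / 4 with hB
    have hBpos : 0 < B := by positivity
    have hapos : 0 < a := by positivity
    have hAB : (t : ℝ) ^ 2 / 4 = B - a := by rw [ha, hB]; ring
    have haB : a ^ 2 ≤ B := by
      rw [ha, hB]
      nlinarith [(Nat.cast_nonneg t : (0 : ℝ) ≤ t)]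
    have haleB : a ≤ B := by
      have : 0 ≤ (t : ℝ) ^ 2 / 4 := by positivity
      linarith
    set τ := a / B with hτ
    have hτ0 : 0 ≤ τ := by positivity
    have hτ1 : τ ≤ 1 := (div_le_one hBpos).mpr haleB
    have hBτ : B * τ = a := by rw [hτ]; field_simp
    set y := (1 - τ) • x + τ • z with hy
    set g := T y + b with hg
    have hyK : y ∈ K t := add_mem (Submodule.smul_mem _ _ hxK) (Submodule.smul_mem _ _ hzK)
    have hgK : g ∈ K (t + 1) := add_mem (hKT t y hyK) (hKb t)
    have hmono := hKmono (Nat.le_succ t)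
    obtain ⟨c, hc, hproj⟩ := exists_smul_ball_projection (norm_nonneg s) (z - (a / L) • g)
    set z' := c • (z - (a / L) • g) with hz'
    have hz'K : z' ∈ K (t + 1) :=
      Submodule.smul_mem _ _ (sub_mem (hmono hzK) (Submodule.smul_mem _ _ hgK))
    set x' := (1 - τ) • x + τ • z' with hx'
    have hx'y : x' = y + τ • (z' - z) := by rw [hx', hy, smul_sub]; abel
    refine ⟨x', add_mem (Submodule.smul_mem _ _ (hmono hxK)) (Submodule.smul_mem _ _ hz'K),
      z', hz'K, ?_, hc, ?_⟩
    · calc ‖x'‖ ≤ ‖(1 - τ) • x‖ + ‖τ • z'‖ := norm_add_le _ _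
        _ = (1 - τ) * ‖x‖ + τ * ‖z'‖ := by
          rw [norm_smul, norm_smul, Real.norm_of_nonneg hτ0,
            Real.norm_of_nonneg (by linarith : 0 ≤ 1 - τ)]
        _ ≤ (1 - τ) * ‖s‖ + τ * ‖s‖ := by
          gcongr
        _ = ‖s‖ := by ring
    · have tx := hT.quadratic_add b y (x - y)
      have ts := hT.quadratic_add b y (s - y)
      have tx' := hT.quadratic_add b y (τ • (z' - z))
      rw [← hx'y] at tx'
      rw [add_sub_cancel] at tx ts
      rw [← hg] at tx ts tx'
      have px := h0 (x - y)
      have ps := h0 (s - y)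
      have pz := h1 (z' - z)
      have hp := hproj s le_rfl
      have hlin : B * inner ℝ g y = (B - a) * inner ℝ g x + a * inner ℝ g z := by
        rw [hy, inner_add_right, inner_smul_right, inner_smul_right, ← hBτ]
        ring
      have hsub : z - (a / L) • g - z' = (z - z') - (a / L) • g := by abel
      rw [hsub, inner_sub_left, inner_smul_left] at hp
      have hnorm : ‖z - s‖ ^ 2 = ‖z - z'‖ ^ 2 - 2 * inner ℝ (z - z') (s - z') + ‖z' - s‖ ^ 2 := by
        have : z - s = (z - z') - (s - z') := by abel
        rw [this, norm_sub_sq_real, norm_sub_rev s z']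
      have hzz : ‖z - z'‖ = ‖z' - z‖ := norm_sub_rev _ _
      have hp' : L * inner ℝ (z - z') (s - z') ≤ a * inner ℝ g (s - z') := by
        have hL' : L * (a / L) = a := by field_simp
        have := mul_le_mul_of_nonneg_left hp hL.le
        simp only [conj_trivial] at this
        rw [mul_sub, ← mul_assoc, hL'] at this
        linarith
      simp only [map_smul, inner_smul_left, inner_smul_right, conj_trivial] at tx'
      simp only [inner_sub_right] at tx ts tx' hp'
      rw [inner_sub_right] at hnorm
      -- The curvature term of the step; half of it is absorbed by the (L/2)‖z − z'‖² that the
      -- projection inequality gains.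
      have hquad : B * (τ * (τ * inner ℝ (z' - z) (T (z' - z)))) ≤ L * ‖z' - z‖ ^ 2 := by
        have e : B * (τ * (τ * inner ℝ (z' - z) (T (z' - z)))) =
            (a ^ 2 / B) * inner ℝ (z' - z) (T (z' - z)) := by
          rw [hτ]; field_simp
        rw [e]
        have hle1 : a ^ 2 / B ≤ 1 := (div_le_one hBpos).mpr haB
        calc _ ≤ 1 * inner ℝ (z' - z) (T (z' - z)) := by gcongr; exact h0 _
          _ ≤ _ := by linarith
      have hcast : ((t + 1 : ℕ) : ℝ) ^ 2 / 4 = B := by rw [hB]; push_cast; ring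
      rw [hcast]
      rw [hAB] at hpot
      rw [hnorm, hzz] at hpot
      have qx := mul_le_mul_of_nonneg_left px (by linarith : 0 ≤ B - a)
      have qs := mul_nonneg hapos.le ps
      have hx'B : B * (1 / 2 * inner ℝ x' (T x') + inner ℝ b x') =
          B * (1 / 2 * inner ℝ y (T y) + inner ℝ b y) + a * (inner ℝ g z' - inner ℝ g z)
          + 1 / 2 * (B * (τ * (τ * inner ℝ (z' - z) (T (z' - z))))) := by
        rw [tx', ← hBτ]; ring
      have hxA := congrArg (fun r => (B - a) * r) tx
      have hsA := congrArg (fun r => a * r) ts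
      linarith

/-- A positive quadratic can be minimized over the ball of radius `‖s‖` at the accelerated rate
within a chain of subspaces. -/
theorem exists_convex_ball_approx (T : E →ₗ[ℝ] E) (hT : T.IsSymmetric) {L : ℝ} (hL : 0 ≤ L)
    (h0 : ∀ x, 0 ≤ inner ℝ x (T x)) (h1 : ∀ x, inner ℝ x (T x) ≤ L * ‖x‖ ^ 2) (b s : E)
    (K : ℕ → Submodule ℝ E) (hKmono : Monotone K) (hKb : ∀ n, b ∈ K (n + 1))
    (hKT : ∀ n, ∀ x ∈ K n, T x ∈ K (n + 1)) {t : ℕ} (ht : 0 < t) :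
    ∃ x ∈ K t, ‖x‖ ≤ ‖s‖ ∧ (1 / 2 * inner ℝ x (T x) + inner ℝ b x)
        - (1 / 2 * inner ℝ s (T s) + inner ℝ b s) ≤ 2 * L * ‖s‖ ^ 2 / (t : ℝ) ^ 2 := by
  have ht' : (0 : ℝ) < t := by exact_mod_cast ht
  rcases hL.eq_or_lt with rfl | hL
  · obtain ⟨n, rfl⟩ : ∃ n, t = n + 1 := ⟨t - 1, by omega⟩
    have hz : ∀ x, inner ℝ x (T x) = 0 := fun x =>
      le_antisymm (by simpa using h1 x) (h0 x)
    -- For L = 0 the objective is linear and this is its exact minimizer on the ball; for b = 0 it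
    -- is the zero vector.
    refine ⟨(-(‖s‖ / ‖b‖)) • b, Submodule.smul_mem _ _ (hKb n), ?_, ?_⟩
    · rw [norm_smul, norm_neg, Real.norm_of_nonneg (by positivity)]
      rcases eq_or_ne b 0 with rfl | hb
      · simp
      · rw [div_mul_cancel₀ _ (norm_ne_zero_iff.mpr hb)]
    · have e : inner ℝ b ((-(‖s‖ / ‖b‖)) • b) = -(‖s‖ * ‖b‖) := by
        rw [inner_smul_right, real_inner_self_eq_norm_sq]
        rcases eq_or_ne b 0 with rfl | hb
        · simp
        · have := norm_ne_zero_iff.mpr hb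
          field_simp
      rw [hz, hz, e]
      have := abs_le.mp (abs_real_inner_le_norm b s)
      simp only [mul_zero, zero_mul, zero_div, zero_add]
      linarith [this.1]
  · obtain ⟨x, hx, z, -, hxs, -, h⟩ :=
      exists_accelerated_iterates T hT hL h0 h1 b s K hKmono hKb hKT t
    refine ⟨x, hx, hxs, ?_⟩
    rw [le_div_iff₀ (by positivity)]
    have := mul_nonneg hL.le (sq_nonneg ‖z - s‖)
    linarith

end ball

/-! ### Polynomials in an operator and chains of subspaces. -/

section krylov

variable {E : Type*} [AddCommGroup E] [Module ℝ E]

/-- Only closure properties of the chain enter, and they pass from an operator to its shifts; hence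
one Krylov chain serves every A + c. -/
theorem aeval_apply_mem_chain {T : E →ₗ[ℝ] E} {b : E} {K : ℕ → Submodule ℝ E}
    (hKmono : Monotone K) (hKb : ∀ n, b ∈ K (n + 1)) (hKT : ∀ n, ∀ x ∈ K n, T x ∈ K (n + 1))
    {p : Polynomial ℝ} {t : ℕ} (hp : p.natDegree < t) : Polynomial.aeval T p b ∈ K t := by
  have hpow : ∀ i, (T ^ i) b ∈ K (i + 1) := by
    intro i
    induction i with
    | zero => simpa using hKb 0
    | succ i ih =>
      rw [pow_succ', Module.End.mul_apply]
      exact hKT _ _ ih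
  rw [Polynomial.aeval_eq_sum_range, LinearMap.sum_apply]
  refine Submodule.sum_mem _ fun i hi => ?_
  rw [LinearMap.smul_apply]
  refine Submodule.smul_mem _ _ (hKmono ?_ (hpow i))
  have := Finset.mem_range.mp hi
  omega

end krylov

/-! ### Chebyshev approximation in an eigenbasis. -/

section spectral

variable {E : Type*} [NormedAddCommGroup E] [InnerProductSpace ℝ E]

theorem LinearMap.IsSymmetric.inner_eigenvector_apply {T : E →ₗ[ℝ] E} (hT : T.IsSymmetric)
    {w : E} {ν : ℝ} (hw : T w = ν • w) (x : E) : inner ℝ w (T x) = ν * inner ℝ w x := by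
  rw [← hT, hw, inner_smul_left, conj_trivial]

theorem LinearMap.IsSymmetric.inner_eigenvector_aeval {T : E →ₗ[ℝ] E} (hT : T.IsSymmetric)
    {w : E} {ν : ℝ} (hw : T w = ν • w) (p : Polynomial ℝ) (x : E) :
    inner ℝ w (Polynomial.aeval T p x) = p.eval ν * inner ℝ w x := by
  induction p using Polynomial.induction_on' with
  | add p q hp hq =>
    rw [map_add, LinearMap.add_apply, inner_add_right, hp, hq, Polynomial.eval_add, add_mul]
  | monomial n a =>
    rw [Polynomial.aeval_monomial, Module.End.mul_apply, Module.algebraMap_end_apply,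
      inner_smul_right, Polynomial.eval_monomial, mul_assoc]
    congr 1
    induction n with
    | zero => simp
    | succ n ih =>
      rw [pow_succ', Module.End.mul_apply, hT.inner_eigenvector_apply hw, ih]
      ring

variable {ι : Type*} [Fintype ι]

theorem OrthonormalBasis.norm_sq_eq_sum (u : OrthonormalBasis ι ℝ E) (x : E) :
    ‖x‖ ^ 2 = ∑ i, inner ℝ (u i) x ^ 2 := by
  rw [← u.sum_sq_norm_inner_right x]
  simp

theorem LinearMap.IsSymmetric.inner_apply_eq_sum {T : E →ₗ[ℝ] E} (hT : T.IsSymmetric)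
    (u : OrthonormalBasis ι ℝ E) {μ : ι → ℝ} (hu : ∀ i, T (u i) = μ i • u i) (x : E) :
    inner ℝ x (T x) = ∑ i, μ i * inner ℝ (u i) x ^ 2 := by
  rw [← u.sum_inner_mul_inner x (T x)]
  refine Finset.sum_congr rfl fun i _ => ?_
  rw [hT.inner_eigenvector_apply (hu i), real_inner_comm]
  ring

theorem LinearMap.IsSymmetric.mul_norm_sq_le_inner {T : E →ₗ[ℝ] E} (hT : T.IsSymmetric)
    (u : OrthonormalBasis ι ℝ E) {μ : ι → ℝ} (hu : ∀ i, T (u i) = μ i • u i) {l : ℝ}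
    (hl : ∀ i, l ≤ μ i) (x : E) : l * ‖x‖ ^ 2 ≤ inner ℝ x (T x) := by
  rw [hT.inner_apply_eq_sum u hu, u.norm_sq_eq_sum, Finset.mul_sum]
  exact Finset.sum_le_sum fun i _ => mul_le_mul_of_nonneg_right (hl i) (sq_nonneg _)

theorem LinearMap.IsSymmetric.inner_le_mul_norm_sq {T : E →ₗ[ℝ] E} (hT : T.IsSymmetric)
    (u : OrthonormalBasis ι ℝ E) {μ : ι → ℝ} (hu : ∀ i, T (u i) = μ i • u i) {L : ℝ}
    (hL : ∀ i, μ i ≤ L) (x : E) : inner ℝ x (T x) ≤ L * ‖x‖ ^ 2 := by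
  rw [hT.inner_apply_eq_sum u hu, u.norm_sq_eq_sum, Finset.mul_sum]
  exact Finset.sum_le_sum fun i _ => mul_le_mul_of_nonneg_right (hL i) (sq_nonneg _)

open Polynomial in
/-- The rescaled Chebyshev polynomial that is normalized at `0` and small on `[l, L]`. -/
theorem exists_polynomial_small_on_Icc {l L : ℝ} (hl : 0 < l) (hlL : l ≤ L) {t : ℕ}
    (ht : 0 < t) :
    ∃ q : ℝ[X], q.natDegree ≤ t ∧ q.eval 0 = 1 ∧
      ∀ z ∈ Set.Icc l L, |q.eval z| ≤ 2 * Real.exp (-2 * t * √(l / L)) := by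
  have hL : 0 < L := hl.trans_le hlL
  rcases hlL.eq_or_lt with rfl | hlt
  · refine ⟨1 - C l⁻¹ * X, ?_, by simp, fun z hz => ?_⟩
    · compute_degree
      omega
    · have : z = l := le_antisymm hz.2 hz.1
      subst this
      simp only [eval_sub, eval_one, eval_mul, eval_C, eval_X, inv_mul_cancel₀ hl.ne', sub_self,
        abs_zero]
      positivity
  · set r := √(l / L) with hr
    have hr2 : r ^ 2 = l / L := Real.sq_sqrt (by positivity)
    have hr0 : 0 ≤ r := Real.sqrt_nonneg _
    have hr1 : r < 1 := by
      rw [hr, Real.sqrt_lt' one_pos, one_pow]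
      exact (div_lt_one hL).mpr hlt
    have hd : 0 < L - l := by linarith
    set y := (1 + r ^ 2) / (1 - r ^ 2) with hy
    have hyv : y = (L + l) / (L - l) := by
      rw [hy, hr2]
      have : (1 - l / L) ≠ 0 := by
        have := (div_lt_one hL).mpr hlt
        linarith
      field_simp
    have hT := half_exp_le_eval_T t hr0 hr1
    rw [← hy] at hT
    set τ := (Chebyshev.T ℝ t).eval y with hτ
    have hτ0 : 0 < τ := lt_of_lt_of_le (by positivity) hT
    -- The affine map sends [l, L] onto [−1, 1] and 0 to y > 1, where `T` is large; dividing by τ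
    -- normalizes at 0.
    refine ⟨C τ⁻¹ * (Chebyshev.T ℝ t).comp (C y - C (2 / (L - l)) * X), ?_, ?_, fun z hz => ?_⟩
    · refine (natDegree_C_mul_le _ _).trans (natDegree_comp_le.trans ?_)
      rw [Chebyshev.natDegree_T, Int.natAbs_natCast]
      have : (C y - C (2 / (L - l)) * X : ℝ[X]).natDegree ≤ 1 := by compute_degree
      nlinarith
    · simp only [eval_mul, eval_C, eval_comp, eval_sub, eval_X, mul_zero, sub_zero]
      exact inv_mul_cancel₀ hτ0.ne'
    · simp only [eval_mul, eval_C, eval_comp, eval_sub, eval_X]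
      have h1 : |y - 2 / (L - l) * z| ≤ 1 := by
        have e : y - 2 / (L - l) * z = (L + l - 2 * z) / (L - l) := by rw [hyv]; field_simp
        rw [e, abs_le, le_div_iff₀ hd, div_le_iff₀ hd]
        exact ⟨by linarith [hz.2], by linarith [hz.1]⟩
      have h2 := Chebyshev.abs_eval_T_real_le_one t h1
      rw [abs_mul, abs_of_pos (inv_pos.mpr hτ0)]
      calc τ⁻¹ * _ ≤ τ⁻¹ * 1 := by gcongr
        _ = τ⁻¹ := mul_one _
        _ ≤ (Real.exp (2 * t * r) / 2)⁻¹ := by gcongr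
        _ = 2 * Real.exp (-2 * t * r) := by
          rw [inv_div, div_eq_mul_inv, ← Real.exp_neg]
          congr 2
          ring

open Polynomial in
/-- The conjugate-gradient approximation of the solution of `T s = -b`, rescaled to the norm
of `s`. -/
theorem exists_normalized_linear_approx {T : E →ₗ[ℝ] E} (hT : T.IsSymmetric)
    (u : OrthonormalBasis ι ℝ E) {μ : ι → ℝ} (hu : ∀ i, T (u i) = μ i • u i) {l L : ℝ}
    (hl : 0 < l) (hlL : l ≤ L) (hμl : ∀ i, l ≤ μ i) (hμL : ∀ i, μ i ≤ L) {b s : E}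
    (hs : T s = -b) {K : ℕ → Submodule ℝ E}
    (hKmono : Monotone K) (hKb : ∀ n, b ∈ K (n + 1)) (hKT : ∀ n, ∀ x ∈ K n, T x ∈ K (n + 1))
    {t : ℕ} (ht : 0 < t) (hε : 2 * Real.exp (-2 * t * √(l / L)) ≤ 1 / 3) :
    ∃ x ∈ K t, ‖x‖ = ‖s‖ ∧ inner ℝ (x - s) (T (x - s)) ≤
      36 * Real.exp (-4 * t * √(l / L)) * inner ℝ s (T s) := by
  obtain ⟨q, hqdeg, hq0, hq⟩ := exists_polynomial_small_on_Icc hl hlL ht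
  set ε := 2 * Real.exp (-2 * t * √(l / L)) with hεdef
  have hε0 : 0 < ε := by positivity
  have hε2 : 36 * Real.exp (-4 * t * √(l / L)) = 9 * ε ^ 2 := by
    rw [hεdef, mul_pow, ← Real.exp_nat_mul]
    push_cast
    ring_nf
  have hqi : ∀ i, |q.eval (μ i)| ≤ ε := fun i => hq _ ⟨hμl i, hμL i⟩
  rcases eq_or_ne s 0 with rfl | hs0
  · exact ⟨0, zero_mem _, rfl, by simp⟩
  have hsn : 0 < ‖s‖ := norm_pos_iff.mpr hs0
  -- As q = 1 + X · `q.divX` and b = −T s, this is (1 − q(T))s; `divX` lowers the degree below t, so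
  -- y stays in `K t`.
  set y := aeval T q.divX b with hy
  have hyK : y ∈ K t := by
    refine aeval_apply_mem_chain hKmono hKb hKT ?_
    rw [natDegree_divX_eq_natDegree_tsub_one]
    omega
  have hycoord : ∀ i, inner ℝ (u i) y = (1 - q.eval (μ i)) * inner ℝ (u i) s := by
    intro i
    have hb : inner ℝ (u i) b = -(μ i * inner ℝ (u i) s) := by
      rw [← hT.inner_eigenvector_apply (hu i), hs, inner_neg_right, neg_neg]
    have hdiv := congrArg (eval (μ i)) (divX_mul_X_add q)
    rw [coeff_zero_eq_eval_zero, hq0] at hdiv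
    simp only [eval_add, eval_mul, eval_X, eval_C] at hdiv
    rw [hy, hT.inner_eigenvector_aeval (hu i), hb, ← hdiv]
    ring
  have hylow : (1 - ε) * ‖s‖ ≤ ‖y‖ := by
    apply le_of_sq_le_sq _ (norm_nonneg _)
    rw [mul_pow, u.norm_sq_eq_sum, u.norm_sq_eq_sum, Finset.mul_sum]
    refine Finset.sum_le_sum fun i _ => ?_
    rw [hycoord, mul_pow]
    have := abs_le.mp (hqi i)
    gcongr
    · linarith
    · linarith
  have hyup : ‖y‖ ≤ (1 + ε) * ‖s‖ := by
    apply le_of_sq_le_sq _ (by positivity)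
    rw [mul_pow, u.norm_sq_eq_sum, u.norm_sq_eq_sum, Finset.mul_sum]
    refine Finset.sum_le_sum fun i _ => ?_
    rw [hycoord, mul_pow]
    have := abs_le.mp (hqi i)
    gcongr
    · linarith
    · linarith
  have hyn : 0 < ‖y‖ := lt_of_lt_of_le (mul_pos (by linarith) hsn) hylow
  set c := ‖s‖ / ‖y‖ with hc
  have hc0 : 0 < c := by positivity
  have hcy : c * ‖y‖ = ‖s‖ := by rw [hc]; field_simp
  have hcup : c * (1 - ε) ≤ 1 := by
    rw [hc, div_mul_eq_mul_div, div_le_one hyn]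
    linarith
  have hclow : 1 ≤ c * (1 + ε) := by
    rw [hc, div_mul_eq_mul_div, one_le_div hyn]
    linarith
  refine ⟨c • y, Submodule.smul_mem _ _ hyK, ?_, ?_⟩
  · rw [norm_smul, Real.norm_of_nonneg hc0.le, hcy]
  · rw [hε2, hT.inner_apply_eq_sum u hu, hT.inner_apply_eq_sum u hu, Finset.mul_sum]
    refine Finset.sum_le_sum fun i _ => ?_
    rw [inner_sub_right, inner_smul_right, hycoord]
    have hq' := abs_le.mp (hqi i)
    -- The upper bound is (1 + ε)/(1 − ε) − 1 = 2ε/(1 − ε) ≤ 3ε, which is where ε ≤ 1/3 is needed.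
    -- Squaring 3ε with ε = 2 exp(…) produces the constant 36.
    have hfac : |c * (1 - q.eval (μ i)) - 1| ≤ 3 * ε := by
      rw [abs_le]
      constructor <;> nlinarith
    have hsq : (c * (1 - q.eval (μ i)) - 1) ^ 2 ≤ (3 * ε) ^ 2 :=
      sq_le_sq' (abs_le.mp hfac).1 (abs_le.mp hfac).2
    have hμ0 : 0 ≤ μ i * inner ℝ (u i) s ^ 2 := mul_nonneg (hl.le.trans (hμl i)) (sq_nonneg _)
    have := mul_le_mul_of_nonneg_left hsq hμ0
    linarith

open Polynomial in
/-- A chain of Krylov subspaces of a positive operator contains good approximations of its null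
vectors. -/
theorem exists_approx_null_vector {T : E →ₗ[ℝ] E} (hT : T.IsSymmetric)
    (u : OrthonormalBasis ι ℝ E) {μ : ι → ℝ} (hu : ∀ i, T (u i) = μ i • u i) {L : ℝ}
    (hμ0 : ∀ i, 0 ≤ μ i) (hμL : ∀ i, μ i ≤ L) {b w : E} (hw : ‖w‖ = 1) (hTw : T w = 0)
    (hwb : inner ℝ w b ≠ 0) {K : ℕ → Submodule ℝ E}
    (hKmono : Monotone K) (hKb : ∀ n, b ∈ K (n + 1)) (hKT : ∀ n, ∀ x ∈ K n, T x ∈ K (n + 1))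
    (n : ℕ) :
    ∃ z ∈ K (n + 1), z ≠ 0 ∧ inner ℝ z (T z) ≤
      L * (Real.log (4 * ‖b‖ ^ 2 / inner ℝ w b ^ 2) / (4 * n + 2)) ^ 2 * ‖z‖ ^ 2 := by
  have hb0 : b ≠ 0 := by
    rintro rfl
    simp at hwb
  have hTle := hT.inner_le_mul_norm_sq u hu hμL
  have hL0 : 0 ≤ L := by
    have h := (hT.mul_norm_sq_le_inner u hu hμ0 w).trans (hTle w)
    simpa [hw] using h
  have hwb2 : 0 < inner ℝ w b ^ 2 := by positivity
  have hcs : inner ℝ w b ^ 2 ≤ ‖b‖ ^ 2 := by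
    have h := abs_real_inner_le_norm w b
    rw [hw, one_mul] at h
    rw [← sq_abs]
    gcongr
  set W := 4 * ‖b‖ ^ 2 / inner ℝ w b ^ 2 with hW
  have hW4 : 4 ≤ W := by
    rw [hW, le_div_iff₀ hwb2]
    linarith
  have hlog : 0 < Real.log W := Real.log_pos (by linarith)
  set r := Real.log W / (4 * n + 2) with hr
  have hr0 : 0 < r := by positivity
  -- In these cases `b` itself serves as z. Otherwise δ = L r² lies strictly between 0 and L.
  by_cases htriv : 1 ≤ r ∨ L = 0
  · refine ⟨b, hKb n, hb0, (hTle b).trans ?_⟩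
    rcases htriv with h | rfl
    · have : L * 1 ≤ L * r ^ 2 := by
        gcongr
        nlinarith
      rw [mul_one] at this
      gcongr
    · simp
  push Not at htriv
  obtain ⟨hr1, hLne⟩ := htriv
  have hL : 0 < L := lt_of_le_of_ne hL0 (Ne.symm hLne)
  have hr2 : r ^ 2 < 1 := by nlinarith
  set δ := L * r ^ 2 with hδ
  have hδ0 : 0 < δ := by positivity
  have hδL : 0 < L - δ := by rw [hδ]; nlinarith
  set y := (1 + r ^ 2) / (1 - r ^ 2) with hy
  have hyv : y = (L + δ) / (L - δ) := by
    have h1 : 1 - r ^ 2 ≠ 0 := by linarith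
    rw [hy, hδ, div_eq_div_iff h1 (by rw [← hδ]; exact hδL.ne')]
    ring
  set τ := (Chebyshev.T ℝ (2 * n + 1)).eval y with hτ
  have hτW : W / 2 ≤ τ := by
    have h := half_exp_le_eval_T (2 * n + 1) hr0.le hr1
    have e : 2 * ((2 * n + 1 : ℕ) : ℝ) * r = Real.log W := by
      rw [hr]
      push_cast
      field_simp
      ring
    rw [e, Real.exp_log (by linarith)] at h
    simpa [hτ, hy] using h
  -- (z − δ)P(z)² is nonpositive below δ, at most L − δ on [δ, L], and very negative at 0, because T
  -- of odd index 2n + 1 is odd. So the null component of b can outweigh all the others in ⟨z, T z⟩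
  -- − δ‖z‖², and r is chosen so that τ ≥ W/2 suffices for this.
  set P : ℝ[X] := (Chebyshev.U ℝ n - Chebyshev.U ℝ (n - 1)).comp
    (C (2 / (L - δ)) * X - C y) with hP
  have hPdeg : P.natDegree ≤ n := by
    refine natDegree_comp_le.trans ?_
    have h1 : (C (2 / (L - δ)) * X - C y : ℝ[X]).natDegree ≤ 1 := by compute_degree
    have h2 : (Chebyshev.U ℝ n - Chebyshev.U ℝ (n - 1)).natDegree ≤ n := by
      refine (natDegree_sub_le _ _).trans (max_le (by simp) ?_)
      rcases n with _ | m
      · simp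
      · simp
    nlinarith
  have hPid : ∀ z, (z - δ) * P.eval z ^ 2 =
      (L - δ) / 2 * (1 + (Chebyshev.T ℝ (2 * n + 1)).eval (2 / (L - δ) * z - y)) := by
    intro z
    have h := congrArg (eval (2 / (L - δ) * z - y)) (one_add_X_mul_sq_U_sub_U n)
    simp only [eval_add, eval_mul, eval_one, eval_X, eval_pow] at h
    rw [← h, hP, eval_comp]
    simp only [eval_sub, eval_mul, eval_C, eval_X]
    rw [← mul_assoc]
    congr 1
    rw [hyv]
    field_simp
    ring
  have hP0 : -δ * P.eval 0 ^ 2 = (L - δ) / 2 * (1 - τ) := by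
    have h := hPid 0
    rw [mul_zero, zero_sub, zero_sub, Chebyshev.T_eval_neg] at h
    rw [h, hτ, Int.negOnePow_odd _ ⟨(n : ℤ), rfl⟩]
    push_cast
    ring
  have hPne : P.eval 0 ≠ 0 := by
    intro h
    rw [h] at hP0
    nlinarith
  have hPle : ∀ i, (μ i - δ) * P.eval (μ i) ^ 2 ≤ (L - δ) / 2 * 2 := by
    intro i
    rcases le_total (μ i) δ with h | h
    · have : (μ i - δ) * P.eval (μ i) ^ 2 ≤ 0 :=
        mul_nonpos_of_nonpos_of_nonneg (by linarith) (sq_nonneg _)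
      linarith
    · rw [hPid]
      have h1 : |2 / (L - δ) * μ i - y| ≤ 1 := by
        have e : 2 / (L - δ) * μ i - y = (2 * μ i - L - δ) / (L - δ) := by
          rw [hyv]; field_simp; ring
        rw [e, abs_le, le_div_iff₀ hδL, div_le_iff₀ hδL]
        exact ⟨by linarith, by linarith [hμL i]⟩
      have h2 := (abs_le.mp (Chebyshev.abs_eval_T_real_le_one (2 * n + 1) h1)).2
      gcongr
      linarith
  refine ⟨aeval T P b, aeval_apply_mem_chain hKmono hKb hKT (by omega), ?_, ?_⟩
  · intro h
    have h1 := hT.inner_eigenvector_aeval (w := w) (ν := 0) (by rw [hTw, zero_smul]) P b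
    rw [h, inner_zero_right] at h1
    exact mul_ne_zero hPne hwb h1.symm
  -- The projection of b onto ker T is at least as long as its component along the single null
  -- vector w.
  · have hB : inner ℝ w b ^ 2 ≤ ∑ i, (if μ i = 0 then inner ℝ (u i) b ^ 2 else 0) := by
      have h1 : inner ℝ w b =
          ∑ i, inner ℝ (u i) w * (if μ i = 0 then inner ℝ (u i) b else 0) := by
        rw [← u.sum_inner_mul_inner w b]
        refine Finset.sum_congr rfl fun i _ => ?_
        rw [real_inner_comm]
        split_ifs with h
        · rfl
        · have h2 := hT.inner_eigenvector_apply (hu i) w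
          rw [hTw, inner_zero_right] at h2
          rcases mul_eq_zero.mp h2.symm with h3 | h3
          · exact absurd h3 h
          · rw [h3]; ring
      rw [h1]
      refine (Finset.sum_mul_sq_le_sq_mul_sq _ _ _).trans ?_
      rw [← u.norm_sq_eq_sum, hw, one_pow, one_mul]
      refine Finset.sum_le_sum fun i _ => ?_
      split_ifs <;> simp
    have hterm : ∀ i, (μ i - δ) * (P.eval (μ i) * inner ℝ (u i) b) ^ 2 ≤
        (L - δ) / 2 * (2 * inner ℝ (u i) b ^ 2
          - (1 + τ) * (if μ i = 0 then inner ℝ (u i) b ^ 2 else 0)) := by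
      intro i
      rw [mul_pow, ← mul_assoc]
      split_ifs with h
      · rw [h, zero_sub, hP0]
        apply le_of_eq
        ring
      · have := mul_le_mul_of_nonneg_right (hPle i) (sq_nonneg (inner ℝ (u i) b))
        linarith
    have hsum := Finset.sum_le_sum fun i (_ : i ∈ Finset.univ) => hterm i
    rw [← Finset.mul_sum, Finset.sum_sub_distrib, ← Finset.mul_sum, ← Finset.mul_sum,
      ← u.norm_sq_eq_sum] at hsum
    have hneg : 2 * ‖b‖ ^ 2
        - (1 + τ) * ∑ i, (if μ i = 0 then inner ℝ (u i) b ^ 2 else 0) ≤ 0 := by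
      have h1 : 2 * ‖b‖ ^ 2 = W / 2 * inner ℝ w b ^ 2 := by
        rw [hW]; field_simp; ring
      have h2 : W / 2 * inner ℝ w b ^ 2 ≤ (1 + τ) * inner ℝ w b ^ 2 := by
        gcongr
        linarith
      have h3 := mul_le_mul_of_nonneg_left hB (by linarith : 0 ≤ 1 + τ)
      linarith
    have hsum0 := hsum.trans (mul_nonpos_of_nonneg_of_nonpos (by linarith) hneg)
    rw [hT.inner_apply_eq_sum u hu, u.norm_sq_eq_sum, Finset.mul_sum, ← sub_nonpos,
      ← Finset.sum_sub_distrib]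
    refine le_trans (le_of_eq (Finset.sum_congr rfl fun i _ => ?_)) hsum0
    rw [hT.inner_eigenvector_aeval (hu i)]
    ring

end spectral

/-! ### Optimality conditions and approximation on the sphere. -/

section trustRegion

variable {E : Type*} [NormedAddCommGroup E] [InnerProductSpace ℝ E]

/-- Divide by ε and let ε tend to 0. All first-order conditions below are extracted this way. -/
theorem nonneg_of_forall_small_quadratic {a c e : ℝ} (he : 0 < e)
    (h : ∀ ε, 0 < ε → ε ≤ e → 0 ≤ ε * a + ε ^ 2 * c) : 0 ≤ a := by
  by_contra! ha
  have hd : 0 < 2 * (|c| + 1) := by positivity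
  set ε := min e (-a / (2 * (|c| + 1))) with hε
  have hε0 : 0 < ε := lt_min he (div_pos (by linarith) hd)
  have h1 := h ε hε0 (min_le_left _ _)
  have h2 : ε * (2 * (|c| + 1)) ≤ -a := (le_div_iff₀ hd).mp (min_le_right _ _)
  have h3 : ε * c ≤ ε * |c| := by
    gcongr
    exact le_abs_self c
  have h4 : 0 ≤ a + ε * c := by
    by_contra! hneg
    nlinarith
  nlinarith [abs_nonneg c]

/-- The operator `T + c`. -/
def LinearMap.shift (T : E →ₗ[ℝ] E) (c : ℝ) : E →ₗ[ℝ] E := T + c • LinearMap.id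

theorem LinearMap.shift_apply (T : E →ₗ[ℝ] E) (c : ℝ) (x : E) : T.shift c x = T x + c • x := rfl

/-- The excess over the value at a stationary point of the Lagrangian. -/
theorem LinearMap.IsSymmetric.quadratic_sub_eq {T : E →ₗ[ℝ] E} (hT : T.IsSymmetric)
    {b s : E} {lam : ℝ} (hs : T s + lam • s + b = 0) (x : E) :
    (1 / 2 * inner ℝ x (T x) + inner ℝ b x) - (1 / 2 * inner ℝ s (T s) + inner ℝ b s) =
      1 / 2 * inner ℝ (x - s) (T.shift lam (x - s))
        + lam / 2 * (‖s‖ ^ 2 - ‖x‖ ^ 2) := by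
  have h := hT.quadratic_add b s (x - s)
  rw [add_sub_cancel] at h
  have hg : T s + b = (-lam) • s := by
    rw [neg_smul, eq_neg_iff_add_eq_zero, ← hs]
    abel
  rw [h, hg, LinearMap.shift_apply, inner_add_right,
    inner_smul_right, inner_smul_left, real_inner_self_eq_norm_sq, norm_sub_sq_real,
    inner_sub_right, real_inner_self_eq_norm_sq, real_inner_comm s x, conj_trivial]
  ring

/-- Necessary optimality conditions for a quadratic on a ball. -/
theorem exists_multiplier_of_isMinOn_ball {T : E →ₗ[ℝ] E} (hT : T.IsSymmetric) {b s v : E}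
    {R ν : ℝ} (hR : 0 < R) (hsR : ‖s‖ ≤ R)
    (hmin : ∀ x : E, ‖x‖ ≤ R →
      1 / 2 * inner ℝ s (T s) + inner ℝ b s ≤ 1 / 2 * inner ℝ x (T x) + inner ℝ b x)
    (hv : ‖v‖ = 1) (hTv : T v = ν • v) :
    ∃ lam : ℝ, T s + lam • s + b = 0 ∧ max (-ν) 0 ≤ lam ∧ lam * (R - ‖s‖) = 0 := by
  set g := T s + b with hg
  have hstep : ∀ (h : E) (ε : ℝ), ‖s + ε • h‖ ≤ R →
      0 ≤ ε * inner ℝ g h + ε ^ 2 * (1 / 2 * inner ℝ h (T h)) := by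
    intro h ε hle
    have h1 := hmin _ hle
    rw [hT.quadratic_add b s (ε • h), ← hg] at h1
    simp only [map_smul, inner_smul_left, inner_smul_right, conj_trivial] at h1
    linarith
  rcases hsR.lt_or_eq with hlt | heq
  · have hinterior : ∀ h : E, ∃ e : ℝ, 0 < e ∧ ∀ ε : ℝ, |ε| ≤ e → ‖s + ε • h‖ ≤ R := by
      intro h
      refine ⟨(R - ‖s‖) / (‖h‖ + 1), div_pos (by linarith) (by positivity), fun ε hε => ?_⟩
      rw [le_div_iff₀ (by positivity)] at hε
      calc ‖s + ε • h‖ ≤ ‖s‖ + |ε| * ‖h‖ := by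
            rw [← Real.norm_eq_abs, ← norm_smul]
            exact norm_add_le _ _
        _ ≤ R := by nlinarith [abs_nonneg ε]
    have hg_nonneg : ∀ h : E, 0 ≤ inner ℝ g h := by
      intro h
      obtain ⟨e, he, hball⟩ := hinterior h
      exact nonneg_of_forall_small_quadratic he fun ε h0 h1 =>
        hstep h ε (hball ε (by rwa [abs_of_pos h0]))
    have hg0 : g = 0 := by
      have h := hg_nonneg (-g)
      rw [inner_neg_right, real_inner_self_eq_norm_sq] at h
      have : ‖g‖ ^ 2 = 0 := le_antisymm (by linarith) (sq_nonneg _)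
      simpa using this
    refine ⟨0, by rw [zero_smul, add_zero, ← hg, hg0], ?_, zero_mul _⟩
    obtain ⟨e, he, hball⟩ := hinterior v
    have h := hstep v e (hball e (abs_of_pos he).le)
    rw [hg0, inner_zero_left, hTv, inner_smul_right, real_inner_self_eq_norm_sq, hv] at h
    have he2 : 0 < e ^ 2 := by positivity
    exact max_le (by nlinarith) le_rfl
  · have hss : inner ℝ s s = R ^ 2 := by rw [real_inner_self_eq_norm_sq, heq]
    have hdir : ∀ h : E, inner ℝ s h < 0 → 0 ≤ inner ℝ g h := by
      intro h hneg
      have hh : 0 < ‖h‖ ^ 2 := by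
        have : h ≠ 0 := by
          rintro rfl
          simp at hneg
        positivity
      refine nonneg_of_forall_small_quadratic (e := -(2 * inner ℝ s h) / ‖h‖ ^ 2)
        (div_pos (by linarith) hh) fun ε h0 h1 => hstep h ε ?_
      rw [le_div_iff₀ hh] at h1
      apply le_of_sq_le_sq _ hR.le
      rw [norm_add_sq_real, norm_smul, inner_smul_right, heq, mul_pow, Real.norm_eq_abs, sq_abs]
      nlinarith
    set lam := -(inner ℝ g s / R ^ 2) with hlam
    have hR2 : 0 < R ^ 2 := by positivity
    have hlamR : lam * R ^ 2 = -inner ℝ g s := by rw [hlam]; field_simp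
    set p := g + lam • s with hp
    have hps : inner ℝ s p = 0 := by
      rw [hp, inner_add_right, inner_smul_right, hss, hlamR, real_inner_comm]
      ring
    have hgp : inner ℝ g p = ‖p‖ ^ 2 := by
      rw [← real_inner_self_eq_norm_sq]
      have h : inner ℝ p p = inner ℝ g p + lam * inner ℝ s p := by
        rw [← real_inner_smul_left, ← inner_add_left]
      rw [h, hps, mul_zero, add_zero]
    have hlam0 : 0 ≤ lam := by
      have h := hdir (-s) (by rw [inner_neg_right, hss]; linarith)
      rw [inner_neg_right] at h
      nlinarith
    have hp0 : p = 0 := by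
      have h : 0 ≤ -‖p‖ ^ 2 := by
        -- −p is only tangent to the sphere; subtracting ε s makes the direction strictly inward, so
        -- `hdir` applies.
        refine nonneg_of_forall_small_quadratic (c := lam * R ^ 2) one_pos fun ε h0 _ => ?_
        have h := hdir (-p - ε • s) (by
          rw [inner_sub_right, inner_neg_right, hps, inner_smul_right, hss]
          nlinarith)
        rw [inner_sub_right, inner_neg_right, hgp, inner_smul_right] at h
        rw [hlamR]
        nlinarith
      have : ‖p‖ ^ 2 = 0 := le_antisymm (by linarith) (sq_nonneg _)
      simpa using this
    have hstat : T s + lam • s + b = 0 := by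
      rw [← hp0, hp, hg]
      abel
    refine ⟨lam, hstat, max_le ?_ hlam0, by rw [heq, sub_self, mul_zero]⟩
    have hsphere : ∀ x : E, ‖x‖ = R →
        0 ≤ inner ℝ (x - s) (T.shift lam (x - s)) := by
      intro x hx
      have h1 := hT.quadratic_sub_eq hstat x
      have h2 := hmin x hx.le
      rw [hx, heq, sub_self, mul_zero, add_zero] at h1
      linarith
    have hcurv : ∀ w : E, inner ℝ s w ≠ 0 →
        0 ≤ inner ℝ w (T.shift lam w) := by
      intro w hw
      have hw0 : w ≠ 0 := by
        rintro rfl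
        simp at hw
      have hwn : 0 < ‖w‖ ^ 2 := by positivity
      -- s + α w is the second intersection of the line s + ℝw with the sphere.
      set α := -(2 * inner ℝ s w) / ‖w‖ ^ 2 with hα
      have hα0 : α ≠ 0 := div_ne_zero (neg_ne_zero.mpr (by simpa using hw)) hwn.ne'
      have hαw : α * ‖w‖ ^ 2 = -(2 * inner ℝ s w) := by rw [hα]; field_simp
      have h := hsphere (s + α • w) (by
        rw [← sq_eq_sq₀ (norm_nonneg _) hR.le, norm_add_sq_real, norm_smul, inner_smul_right,
          heq, mul_pow, Real.norm_eq_abs, sq_abs]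
        linear_combination α * hαw)
      rw [add_sub_cancel_left, map_smul, inner_smul_left, inner_smul_right, conj_trivial,
        ← mul_assoc] at h
      have : 0 < α * α := mul_self_pos.mpr hα0
      nlinarith
    have hMv : T.shift lam v = (ν + lam) • v := by
      rw [LinearMap.shift_apply, hTv, add_smul]
    rcases ne_or_eq (inner ℝ s v) 0 with hsv | hsv
    · have h := hcurv v hsv
      rw [hMv, inner_smul_right, real_inner_self_eq_norm_sq, hv] at h
      linarith
    · have hMs : inner ℝ v (T.shift lam s) = 0 := by
        rw [LinearMap.shift_apply, inner_add_right,
          inner_smul_right, hT.inner_eigenvector_apply hTv, real_inner_comm, hsv]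
        ring
      have h : 0 ≤ ν + lam := by
        -- When v ⟂ s the line along v is tangent and meets the sphere only at s, so v is tilted to
        -- v + ε s.
        refine nonneg_of_forall_small_quadratic
          (c := |inner ℝ s (T.shift lam s)|) one_pos fun ε h0 hε1 => ?_
        have h := hcurv (v + ε • s) (by
          rw [inner_add_right, inner_smul_right, hsv, hss, zero_add]
          positivity)
        rw [map_add, map_smul, inner_add_left, inner_add_right, inner_add_right, hMv,
          inner_smul_right, inner_smul_right, inner_smul_right, inner_smul_left,
          inner_smul_left, hMs, real_inner_self_eq_norm_sq, hv, hsv, conj_trivial] at h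
        have hq : ε ^ 2 * inner ℝ s (T.shift lam s) ≤ ε * |inner ℝ s (T.shift lam s)| := by
          calc _ ≤ ε ^ 2 * |inner ℝ s (T.shift lam s)| := by
                gcongr
                exact le_abs_self _
            _ ≤ ε * |inner ℝ s (T.shift lam s)| := by
                gcongr
                nlinarith
        rw [inner_smul_right] at h
        have h' : 0 ≤ ν + lam + ε * |inner ℝ s (T.shift lam s)| := by linarith
        nlinarith [mul_nonneg h0.le h']
      linarith

/-- The quadratic equation for α has roots with product (‖y‖² − R²)/‖z‖² ≤ 0; α is the larger root.
-/
theorem exists_nonneg_norm_add_smul_eq {y z : E} {R : ℝ} (hz : z ≠ 0) (hy : ‖y‖ ≤ R) :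
    ∃ α : ℝ, 0 ≤ α ∧ ‖y + α • z‖ = R := by
  have hR : 0 ≤ R := (norm_nonneg y).trans hy
  have hzn : 0 < ‖z‖ ^ 2 := by positivity
  have hy2 : ‖y‖ ^ 2 ≤ R ^ 2 := by gcongr
  set D := √(inner ℝ y z ^ 2 + ‖z‖ ^ 2 * (R ^ 2 - ‖y‖ ^ 2)) with hD
  have hrad : 0 ≤ ‖z‖ ^ 2 * (R ^ 2 - ‖y‖ ^ 2) := mul_nonneg hzn.le (by linarith)
  have hD2 : D ^ 2 = inner ℝ y z ^ 2 + ‖z‖ ^ 2 * (R ^ 2 - ‖y‖ ^ 2) :=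
    Real.sq_sqrt (by positivity)
  have hDge : inner ℝ y z ≤ D := Real.le_sqrt_of_sq_le (by linarith)
  set α := (D - inner ℝ y z) / ‖z‖ ^ 2 with hα
  have hαz : α * ‖z‖ ^ 2 = D - inner ℝ y z := by rw [hα]; field_simp
  refine ⟨α, div_nonneg (by linarith) hzn.le, ?_⟩
  rw [← sq_eq_sq₀ (norm_nonneg _) hR, norm_add_sq_real, norm_smul, inner_smul_right, mul_pow,
    Real.norm_eq_abs, sq_abs]
  apply mul_left_cancel₀ hzn.ne'
  linear_combination hD2 + (α * ‖z‖ ^ 2 + D + inner ℝ y z) * hαz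

/-- A point of the ball can be moved to the sphere along a given line in a direction of descent. -/
theorem exists_norm_add_smul_eq_and_mul_nonpos {y z : E} {R : ℝ} (hz : z ≠ 0) (hy : ‖y‖ ≤ R)
    (c : ℝ) : ∃ α : ℝ, ‖y + α • z‖ = R ∧ α * c ≤ 0 := by
  rcases le_total c 0 with hc | hc
  · obtain ⟨α, hα, h⟩ := exists_nonneg_norm_add_smul_eq hz hy
    exact ⟨α, h, mul_nonpos_of_nonneg_of_nonpos hα hc⟩
  · obtain ⟨α, hα, h⟩ := exists_nonneg_norm_add_smul_eq (neg_ne_zero.mpr hz) hy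
    exact ⟨-α, by simpa using h, mul_nonpos_of_nonpos_of_nonneg (by linarith) hc⟩

variable {ι : Type*} [Fintype ι]

/-- Sublinear rate on the sphere, for an operator with a null vector that is not orthogonal
to `b`. -/
theorem exists_sphere_approx {T : E →ₗ[ℝ] E} (hT : T.IsSymmetric)
    (u : OrthonormalBasis ι ℝ E) {μ : ι → ℝ} (hu : ∀ i, T (u i) = μ i • u i) {L : ℝ}
    (hL : 0 ≤ L) (hμ0 : ∀ i, 0 ≤ μ i) (hμL : ∀ i, μ i ≤ L) {b w : E} (s : E) (hw : ‖w‖ = 1)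
    (hTw : T w = 0) (hwb : inner ℝ w b ≠ 0) {K : ℕ → Submodule ℝ E}
    (hKmono : Monotone K) (hKb : ∀ n, b ∈ K (n + 1)) (hKT : ∀ n, ∀ x ∈ K n, T x ∈ K (n + 1))
    (n : ℕ) :
    ∃ x ∈ K (n + 1), ‖x‖ = ‖s‖ ∧ (1 / 2 * inner ℝ x (T x) + inner ℝ b x)
        - (1 / 2 * inner ℝ s (T s) + inner ℝ b s) ≤
      2 * L * ‖s‖ ^ 2 / ((n + 1 : ℕ) : ℝ) ^ 2 +
        2 * L * ‖s‖ ^ 2 * (Real.log (4 * ‖b‖ ^ 2 / inner ℝ w b ^ 2) / (4 * n + 2)) ^ 2 := by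
  obtain ⟨y, hyK, hys, hy⟩ := exists_convex_ball_approx T hT hL
    (fun x => by simpa using hT.mul_norm_sq_le_inner u hu hμ0 x)
    (hT.inner_le_mul_norm_sq u hu hμL) b s K hKmono hKb hKT n.succ_pos
  obtain ⟨z, hzK, hz0, hz⟩ :=
    exists_approx_null_vector hT u hu hμ0 hμL hw hTw hwb hKmono hKb hKT n
  obtain ⟨α, hα, hαc⟩ :=
    exists_norm_add_smul_eq_and_mul_nonpos hz0 hys (inner ℝ (T y + b) z)
  refine ⟨y + α • z, add_mem hyK (Submodule.smul_mem _ _ hzK), hα, ?_⟩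
  set δ := (Real.log (4 * ‖b‖ ^ 2 / inner ℝ w b ^ 2) / (4 * n + 2)) ^ 2 with hδ
  have hδ0 : 0 ≤ δ := sq_nonneg _
  -- Both ends of the move lie in the ball of radius ‖s‖, so its length is at most the diameter.
  have hαz : ‖α • z‖ ≤ 2 * ‖s‖ := by
    have h := norm_sub_le (y + α • z) y
    rw [add_sub_cancel_left] at h
    linarith
  have hαz2 : α ^ 2 * ‖z‖ ^ 2 ≤ 4 * ‖s‖ ^ 2 := by
    have h : ‖α • z‖ ^ 2 ≤ (2 * ‖s‖) ^ 2 := by gcongr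
    rw [norm_smul, mul_pow, Real.norm_eq_abs, sq_abs] at h
    linarith
  rw [hT.quadratic_add b y (α • z)]
  simp only [map_smul, inner_smul_left, inner_smul_right, conj_trivial]
  have h1 := mul_le_mul_of_nonneg_left hz (sq_nonneg α)
  have h2 := mul_le_mul_of_nonneg_left hαz2 (mul_nonneg hL hδ0)
  nlinarith

end trustRegion

/-! ### Krylov spaces of a matrix and the two rates. -/

section matrix

variable {d : ℕ} {A : Matrix (Fin d) (Fin d) ℝ} {b : EuclideanSpace ℝ (Fin d)}

theorem Matrix.IsSymm.isHermitian_real (hA : A.IsSymm) : A.IsHermitian := by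
  rw [Matrix.IsHermitian, Matrix.conjTranspose_eq_transpose_of_trivial]
  exact hA

theorem toEuclideanLin_eigenvectorBasis (hA : A.IsHermitian) (i : Fin d) :
    A.toEuclideanLin (hA.eigenvectorBasis i) = hA.eigenvalues i • hA.eigenvectorBasis i := by
  ext j
  have h := congrFun (hA.mulVec_eigenvectorBasis i) j
  simpa [Matrix.toLpLin_apply] using h

theorem lambdaMin_le_eigenvalues (hA : A.IsHermitian) (i : Fin d) :
    lambdaMin A ≤ hA.eigenvalues i :=
  csInf_le Matrix.finite_real_spectrum.bddBelow (hA.eigenvalues_mem_spectrum_real i)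

theorem eigenvalues_le_lambdaMax (hA : A.IsHermitian) (i : Fin d) :
    hA.eigenvalues i ≤ lambdaMax A :=
  le_csSup Matrix.finite_real_spectrum.bddAbove (hA.eigenvalues_mem_spectrum_real i)

theorem krylovSpace_mono : Monotone (krylovSpace A b) := by
  intro m n hmn
  refine Submodule.span_mono ?_
  rintro x ⟨i, hi, rfl⟩
  exact ⟨i, hi.trans_le hmn, rfl⟩

theorem mem_krylovSpace_succ (n : ℕ) : b ∈ krylovSpace A b (n + 1) :=
  Submodule.subset_span ⟨0, n.succ_pos, by simp⟩

theorem toEuclideanLin_mem_krylovSpace (n : ℕ) (x : EuclideanSpace ℝ (Fin d))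
    (hx : x ∈ krylovSpace A b n) : A.toEuclideanLin x ∈ krylovSpace A b (n + 1) := by
  induction hx using Submodule.span_induction with
  | mem x hx =>
    obtain ⟨i, hi, rfl⟩ := hx
    refine Submodule.subset_span ⟨i + 1, by omega, ?_⟩
    rw [Matrix.toLpLin_pow, Matrix.toLpLin_pow, pow_succ', Module.End.mul_apply]
  | zero => simp
  | add x y _ _ hx hy => rw [map_add]; exact add_mem hx hy
  | smul c x _ hx => rw [map_smul]; exact Submodule.smul_mem _ _ hx

theorem shift_mem_krylovSpace (c : ℝ) (n : ℕ) (x : EuclideanSpace ℝ (Fin d))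
    (hx : x ∈ krylovSpace A b n) :
    A.toEuclideanLin.shift c x ∈ krylovSpace A b (n + 1) :=
  add_mem (toEuclideanLin_mem_krylovSpace n x hx)
    (Submodule.smul_mem _ _ (krylovSpace_mono n.le_succ hx))

theorem isSymmetric_shift (hA : A.IsHermitian) (c : ℝ) :
    (A.toEuclideanLin.shift c).IsSymmetric := by
  have h := Matrix.isSymmetric_toEuclideanLin_iff.mpr hA
  intro x y
  simp only [LinearMap.shift_apply, inner_add_left,
    inner_add_right, inner_smul_left, inner_smul_right, conj_trivial, h x y]

theorem shift_eigenvectorBasis (hA : A.IsHermitian) (c : ℝ) (i : Fin d) :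
    A.toEuclideanLin.shift c (hA.eigenvectorBasis i) =
      (hA.eigenvalues i + c) • hA.eigenvectorBasis i := by
  rw [LinearMap.shift_apply,
    toEuclideanLin_eigenvectorBasis, add_smul]

/-- Shifting changes the objective only through ‖x‖², so differences between points of equal norm
are unaffected. -/
theorem quadObj_eq_shift (c : ℝ) (x : EuclideanSpace ℝ (Fin d)) :
    quadObj A b x = (1 / 2 * inner ℝ x (A.toEuclideanLin.shift c x) + inner ℝ b x)
      - c / 2 * ‖x‖ ^ 2 := by
  rw [quadObj, LinearMap.shift_apply, inner_add_right,
    inner_smul_right, real_inner_self_eq_norm_sq]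
  ring

/-- Uniqueness comes from stationarity if s ≠ 0, and from complementarity, which then reads λR = 0,
if s = 0. -/
theorem existsUnique_isTRMultiplier (hA : A.IsHermitian) {R : ℝ} (hR : 0 < R)
    {s v : EuclideanSpace ℝ (Fin d)} (hs : IsTRSolution A b R s) (hv : ‖v‖ = 1)
    (hvA : A.toEuclideanLin v = lambdaMin A • v) : ∃! lam : ℝ, IsTRMultiplier A b R s lam := by
  obtain ⟨lam, h1, h2, h3⟩ := exists_multiplier_of_isMinOn_ball
    (Matrix.isSymmetric_toEuclideanLin_iff.mpr hA) hR hs.1 (fun x hx => hs.2 hx) hv hvA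
  refine ⟨lam, ⟨h1, h2, h3⟩, fun lam' ⟨g1, _, g3⟩ => ?_⟩
  rcases eq_or_ne s 0 with rfl | hs0
  · simp only [norm_zero, sub_zero, mul_eq_zero, hR.ne', or_false] at h3 g3
    rw [h3, g3]
  · have h : lam' • s = lam • s := by
      have h4 := g1.trans h1.symm
      rwa [add_left_inj, add_right_inj] at h4
    exact smul_left_injective ℝ hs0 h

theorem IsKrylovTRSolution.quadObj_le_zero {R : ℝ} (hR : 0 < R) {t : ℕ}
    {x : EuclideanSpace ℝ (Fin d)} (hx : IsKrylovTRSolution A b R t x) :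
    quadObj A b x ≤ quadObj A b 0 :=
  hx.2 ⟨zero_mem _, by simpa using hR.le⟩

theorem krylov_linear_rate (hA : A.IsHermitian) {R : ℝ} (hR : 0 < R)
    {s : EuclideanSpace ℝ (Fin d)} (hs : IsTRSolution A b R s) (hlL : lambdaMin A ≤ lambdaMax A)
    {t : ℕ} (ht : 0 < t) {x : EuclideanSpace ℝ (Fin d)} (hx : IsKrylovTRSolution A b R t x)
    {lam : ℝ} (hlam : IsTRMultiplier A b R s lam) :
    quadObj A b x - quadObj A b s ≤ 36 * (quadObj A b 0 - quadObj A b s) *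
      Real.exp (-4 * (t : ℝ) * √((lambdaMin A + lam) / (lambdaMax A + lam))) := by
  obtain ⟨hstat, hmax, -⟩ := hlam
  have hT := Matrix.isSymmetric_toEuclideanLin_iff.mpr hA
  have hx0 := hx.quadObj_le_zero hR
  have hs0 : quadObj A b s ≤ quadObj A b 0 := hs.2 (by simpa using hR.le)
  set e := Real.exp (-4 * (t : ℝ) * √((lambdaMin A + lam) / (lambdaMax A + lam))) with he
  have htriv : 1 ≤ 36 * e → quadObj A b x - quadObj A b s ≤
      36 * (quadObj A b 0 - quadObj A b s) * e := by
    intro h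
    have := mul_le_mul_of_nonneg_left h (sub_nonneg.mpr hs0)
    linarith
  have hl0 : 0 ≤ lambdaMin A + lam := by linarith [(le_max_left _ _).trans hmax]
  have hlam0 : 0 ≤ lam := (le_max_right _ _).trans hmax
  rcases hl0.eq_or_lt with hl | hl
  -- Ratio 0, so the exponential is 1. This includes λ_max + λ = 0, which forces λ_min + λ = 0.
  · apply htriv
    rw [he, ← hl]
    simp
  by_cases hε : 2 * Real.exp (-2 * t * √((lambdaMin A + lam) / (lambdaMax A + lam))) ≤ 1 / 3
  · obtain ⟨y, hyK, hys, hy⟩ := exists_normalized_linear_approx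
      (μ := fun i => hA.eigenvalues i + lam) (isSymmetric_shift hA lam)
      hA.eigenvectorBasis (shift_eigenvectorBasis hA lam) hl (by linarith)
      (fun i => by linarith [lambdaMin_le_eigenvalues hA i])
      (fun i => by linarith [eigenvalues_le_lambdaMax hA i]) (b := b) (s := s)
      (by
        rw [LinearMap.shift_apply]
        exact eq_neg_of_add_eq_zero_left hstat)
      krylovSpace_mono mem_krylovSpace_succ (shift_mem_krylovSpace lam) ht hε
    have hxy : quadObj A b x ≤ quadObj A b y := hx.2 ⟨hyK, hys.le.trans hs.1⟩
    have h1 : quadObj A b y - quadObj A b s = _ := hT.quadratic_sub_eq hstat y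
    have h2 : quadObj A b 0 - quadObj A b s = _ := hT.quadratic_sub_eq hstat 0
    rw [hys, sub_self, mul_zero, add_zero] at h1
    rw [zero_sub, map_neg, inner_neg_neg, norm_zero] at h2
    have h3 : inner ℝ s (A.toEuclideanLin.shift lam s) ≤
        2 * (quadObj A b 0 - quadObj A b s) := by
      rw [h2]
      nlinarith [sq_nonneg ‖s‖]
    rw [← he] at hy
    have h4 := mul_le_mul_of_nonneg_left h3 (by positivity : 0 ≤ 36 * e)
    linarith
  -- Failure of ε ≤ 1/3 means 36e > 1, and then f(x) ≤ f(0) is already enough.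
  · apply htriv
    have h1 := not_le.mp hε
    have h2 : e = Real.exp (-2 * t * √((lambdaMin A + lam) / (lambdaMax A + lam))) ^ 2 := by
      rw [he, ← Real.exp_nat_mul]
      push_cast
      ring_nf
    rw [h2]
    nlinarith

theorem krylov_sublinear_rate (hA : A.IsHermitian) {R : ℝ} (hR : 0 < R)
    {s v : EuclideanSpace ℝ (Fin d)} (hs : IsTRSolution A b R s) (hv : ‖v‖ = 1)
    (hvA : A.toEuclideanLin v = lambdaMin A • v) (hlL : lambdaMin A ≤ lambdaMax A)
    {t : ℕ} (ht : 0 < t) {x : EuclideanSpace ℝ (Fin d)} (hx : IsKrylovTRSolution A b R t x)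
    (hvb : lambdaMin A < 0 → inner ℝ v b ≠ 0) :
    quadObj A b x - quadObj A b s ≤
      (lambdaMax A - lambdaMin A) * ‖s‖ ^ 2 / ((t : ℝ) - 1 / 2) ^ 2 *
        (4 + (if lambdaMin A < 0 then (1 : ℝ) else 0) / 8 *
          Real.log (4 * ‖b‖ ^ 2 / (inner ℝ v b) ^ 2) ^ 2) := by
  obtain ⟨n, rfl⟩ : ∃ n, t = n + 1 := ⟨t - 1, by omega⟩
  set L := lambdaMax A - lambdaMin A with hL
  have hL0 : 0 ≤ L := sub_nonneg.mpr hlL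
  set c := -lambdaMin A with hc
  have hμ0 : ∀ i, 0 ≤ hA.eigenvalues i + c := fun i => by
    linarith [lambdaMin_le_eigenvalues hA i]
  have hμL : ∀ i, hA.eigenvalues i + c ≤ L := fun i => by
    linarith [eigenvalues_le_lambdaMax hA i]
  have hS := isSymmetric_shift hA c
  have hn : (0 : ℝ) ≤ n := Nat.cast_nonneg n
  have hhalf : ((n + 1 : ℕ) : ℝ) - 1 / 2 = n + 1 / 2 := by push_cast; ring
  have hbase : 2 * L * ‖s‖ ^ 2 / ((n + 1 : ℕ) : ℝ) ^ 2 ≤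
      L * ‖s‖ ^ 2 / ((n : ℝ) + 1 / 2) ^ 2 * 4 := by
    have h1 : 2 * L * ‖s‖ ^ 2 / ((n + 1 : ℕ) : ℝ) ^ 2 ≤
        2 * L * ‖s‖ ^ 2 / ((n : ℝ) + 1 / 2) ^ 2 := by
      gcongr
      push_cast
      linarith
    have h2 : 0 ≤ L * ‖s‖ ^ 2 / ((n : ℝ) + 1 / 2) ^ 2 := by positivity
    have h3 : 2 * L * ‖s‖ ^ 2 / ((n : ℝ) + 1 / 2) ^ 2 =
        2 * (L * ‖s‖ ^ 2 / ((n : ℝ) + 1 / 2) ^ 2) := by ring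
    linarith
  rw [hhalf]
  split_ifs with hneg
  · have hsR : ‖s‖ = R := by
      obtain ⟨lam, ⟨-, hmax, hcomp⟩, -⟩ := existsUnique_isTRMultiplier hA hR hs hv hvA
      have hlam : 0 < lam := by linarith [(le_max_left _ _).trans hmax]
      rcases mul_eq_zero.mp hcomp with h | h <;> linarith
    have hSv : A.toEuclideanLin.shift c v = 0 := by
      rw [LinearMap.shift_apply, hvA, hc, ← add_smul]
      simp
    obtain ⟨y, hyK, hys, hy⟩ := exists_sphere_approx hS hA.eigenvectorBasis
      (shift_eigenvectorBasis hA c) hL0 hμ0 hμL s hv hSv (hvb hneg)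
      krylovSpace_mono mem_krylovSpace_succ (shift_mem_krylovSpace c) n
    have hxy : quadObj A b x ≤ quadObj A b y := hx.2 ⟨hyK, (hys.trans hsR).le⟩
    rw [quadObj_eq_shift c y, hys] at hxy
    rw [quadObj_eq_shift c s]
    -- 4n + 2 = 4(t − ½): the half comes from the odd index 2n + 1 = 2t − 1, and 1/8 is 2/4².
    have hlog : 2 * L * ‖s‖ ^ 2 * (Real.log (4 * ‖b‖ ^ 2 / inner ℝ v b ^ 2) / (4 * n + 2)) ^ 2 =
        L * ‖s‖ ^ 2 / ((n : ℝ) + 1 / 2) ^ 2 *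
          (1 / 8 * Real.log (4 * ‖b‖ ^ 2 / inner ℝ v b ^ 2) ^ 2) := by
      have e : (4 * n + 2 : ℝ) = 4 * (n + 1 / 2) := by ring
      rw [e]
      field_simp
      ring
    rw [mul_add, ← hlog]
    linarith
  · obtain ⟨y, hyK, hys, hy⟩ := exists_convex_ball_approx _ hS hL0
      (fun x => by
        simpa using hS.mul_norm_sq_le_inner hA.eigenvectorBasis (shift_eigenvectorBasis hA c) hμ0 x)
      (hS.inner_le_mul_norm_sq hA.eigenvectorBasis (shift_eigenvectorBasis hA c) hμL)
      b s (krylovSpace A b) krylovSpace_mono mem_krylovSpace_succ (shift_mem_krylovSpace c) ht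
    have hxy : quadObj A b x ≤ quadObj A b y := hx.2 ⟨hyK, hys.trans hs.1⟩
    rw [quadObj_eq_shift c y] at hxy
    rw [quadObj_eq_shift c s, zero_div, zero_mul, add_zero]
    -- Here −c = λ_min ≥ 0, so the norm term removed by the shift favours y over s.
    have h1 : ‖y‖ ^ 2 ≤ ‖s‖ ^ 2 := by gcongr
    have h2 : 0 ≤ -c := by linarith
    nlinarith

end matrix

theorem theorem4p1 {d : ℕ} (hd : 0 < d) (A : Matrix (Fin d) (Fin d) ℝ) (hA : A.IsSymm)
    (b : EuclideanSpace ℝ (Fin d)) (R : ℝ) (hR : 0 < R)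
    (s : EuclideanSpace ℝ (Fin d)) (hs : IsTRSolution A b R s)
    (v : EuclideanSpace ℝ (Fin d)) (hv : ‖v‖ = 1) (hvA : A.toEuclideanLin v = lambdaMin A • v) :
    (∃! lam : ℝ, IsTRMultiplier A b R s lam) ∧
    ∀ t : ℕ, 0 < t → ∀ x : EuclideanSpace ℝ (Fin d), IsKrylovTRSolution A b R t x →
      (∀ lam : ℝ, IsTRMultiplier A b R s lam →
        quadObj A b x - quadObj A b s ≤
          36 * (quadObj A b 0 - quadObj A b s) *
            Real.exp (-4 * (t : ℝ) * √((lambdaMin A + lam) / (lambdaMax A + lam)))) ∧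
      ((lambdaMin A < 0 → inner ℝ v b ≠ 0) →
        quadObj A b x - quadObj A b s ≤
          (lambdaMax A - lambdaMin A) * ‖s‖ ^ 2 / ((t : ℝ) - 1 / 2) ^ 2 *
            (4 + (if lambdaMin A < 0 then (1 : ℝ) else 0) / 8 *
              Real.log (4 * ‖b‖ ^ 2 / (inner ℝ v b) ^ 2) ^ 2)) := by
  have hH := hA.isHermitian_real
  have hlL : lambdaMin A ≤ lambdaMax A :=
    (lambdaMin_le_eigenvalues hH ⟨0, hd⟩).trans (eigenvalues_le_lambdaMax hH ⟨0, hd⟩)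
  exact ⟨existsUnique_isTRMultiplier hH hR hs hv hvA, fun t ht x hx =>
    ⟨fun lam hlam => krylov_linear_rate hH hR hs hlL ht hx hlam,
      fun hvb => krylov_sublinear_rate hH hR hs hv hvA hlL ht hx hvb⟩⟩
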